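/- Let $D\subset\mathbb C^n$ be a bounded domain and let $p\in\partial D$ be a $\mathcal C^{1,1}$-smooth boundary point, i.e. in a neighbourhood of $p$ the set $D$ is given by $\{s<0\}$ for a real function $s$ with Lipschitz derivative and $ds(p)\neq0$. No pseudoconvexity is assumed. Write $\langle Z,W\rangle=\sum_j Z_j\overline{W_j}$, $|Z|^2=\langle Z,Z\rangle$ and $\delta_D(z)=\operatorname{dist}(z,\partial D)$. For $X\in\mathbb C^n$ and $z\in D$ near $p$ put $X_z=2\langle X,\bar\partial\delta_D(z)\rangle$; this is $\langle X,n_{\pi(z)}\rangle$, where $\pi(z)$ is the boundary point nearest to $z$ and $n_{\pi(z)}$ the inner unit normal there. Set $$H_D(z,w)=\frac{|(z-w)_z|}{\sqrt{|(z-w)_z|}+|z-w|+\sqrt{\delta_D(z)}}+|z-w| .$$ Let $k_D$ be the Kobayashi pseudodistance of $D$, i.e. the largest pseudodistance not exceeding the Lempert function $$l_D(z,w)=\inf\{\tanh^{-1}|\alpha| : \exists\,\varphi:\mathbb D\to D \text{ holomorphic with } \varphi(0)=z,\ \varphi(\alpha)=w\},$$ where $\mathbb D$ is the unit disc. Then there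 are a neighbourhood $U$ of $p$ and constants $c,c'>0$ (depending on $D$ and $p$) such that every $z\in D\cap U$ has a unique nearest boundary point and $\delta_D$ is differentiable at $z$ (so that $H_D$ is well defined on $D\cap U$), and for all $z,w\in D\cap U$ $$k_D(z,w)\ \ge\ c\,H_D(z,w).$$ In particular, for all $z,w\in D\cap U$, $$k_D(z,w)\ \ge\ c'\left(|z-w|+\left|\sqrt{\delta_D(z)}-\sqrt{\delta_D(w)}\right|\right).$$ -/

import Mathlib

open scoped Topology NNReal ENNReal

noncomputable section

/-- `ℂⁿ` with its usual Hermitian norm. -/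
abbrev Cn (n : ℕ) : Type := EuclideanSpace ℂ (Fin n)

/-- `⟨Z, W⟩ = ∑ j, Z j * conj (W j)`. -/
def herm {n : ℕ} (Z W : Cn n) : ℂ :=
  ∑ j, Z j * (starRingEnd ℂ) (W j)

/-- `δ_D(z) = inf_{q ∈ ∂D} |z - q|`. -/
def bdryDist {n : ℕ} (D : Set (Cn n)) (z : Cn n) : ℝ :=
  Metric.infDist z (frontier D)

/-- `q` is a nearest boundary point to `z`. -/
def IsNearestBdryPoint {n : ℕ} (D : Set (Cn n)) (z q : Cn n) : Prop :=
  q ∈ frontier D ∧ dist z q = bdryDist D z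

/-- The vector `∂̄δ_D(z)`, whose `j`-th entry is
`∂δ_D/∂z̄_j = (∂δ_D/∂x_j + i ∂δ_D/∂y_j) / 2` at `z`. -/
def dbarBdryDist {n : ℕ} (D : Set (Cn n)) (z : Cn n) : Cn n :=
  WithLp.toLp 2 fun j =>
    (1 / 2 : ℂ) *
      ((fderiv ℝ (bdryDist D) z (EuclideanSpace.single j (1 : ℂ)) : ℂ) +
        Complex.I * (fderiv ℝ (bdryDist D) z (EuclideanSpace.single j Complex.I) : ℂ))

/-- `X_z = 2 ⟨X, ∂̄δ_D(z)⟩`, the component of `X` along the complex normal to `∂D` at the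
boundary point closest to `z`. -/
def normalComp {n : ℕ} (D : Set (Cn n)) (z X : Cn n) : ℂ :=
  2 * herm X (dbarBdryDist D z)

/-- The quantity `H_D(z, w)`. -/
def HD {n : ℕ} (D : Set (Cn n)) (z w : Cn n) : ℝ :=
  ‖normalComp D z (z - w)‖ /
      (√‖normalComp D z (z - w)‖ + ‖z - w‖ + √(bdryDist D z)) + ‖z - w‖

/-- `p` is a `C^{1,1}`-smooth boundary point of `D`: near `p`, the set `D` is the sublevel set
`{s < 0}` of a differentiable real function `s` with Lipschitz derivative, and `ds(p) ≠ 0`. -/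
def IsC11BdryPoint {n : ℕ} (D : Set (Cn n)) (p : Cn n) : Prop :=
  p ∈ frontier D ∧
    ∃ (V : Set (Cn n)) (s : Cn n → ℝ) (K : ℝ≥0),
      IsOpen V ∧ p ∈ V ∧ DifferentiableOn ℝ s V ∧ LipschitzOnWith K (fderiv ℝ s) V ∧
        fderiv ℝ s p ≠ 0 ∧ ∀ x ∈ V, x ∈ D ↔ s x < 0

/-- The Lempert function `l_D(z, w)`: the infimum of `artanh |α|` over all holomorphic maps
`φ` from the unit disc to `D` and all `α` in the unit disc with `φ 0 = z` and `φ α = w`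
(and `∞` if there are none). -/
def lempert {n : ℕ} (D : Set (Cn n)) (z w : Cn n) : ℝ≥0∞ :=
  ⨅ (φ : ℂ → Cn n) (α : ℂ)
    (_ : DifferentiableOn ℂ φ (Metric.ball 0 1) ∧ Set.MapsTo φ (Metric.ball 0 1) D ∧
      α ∈ Metric.ball (0 : ℂ) 1 ∧ φ 0 = z ∧ φ α = w),
    ENNReal.ofReal (Real.artanh ‖α‖)

/-- `d` restricts to a (finite) pseudodistance on `D`. -/
structure IsPseudodistOn {n : ℕ} (D : Set (Cn n)) (d : Cn n → Cn n → ℝ) : Prop where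
  nonneg : ∀ z ∈ D, ∀ w ∈ D, 0 ≤ d z w
  self : ∀ z ∈ D, d z z = 0
  symm : ∀ z ∈ D, ∀ w ∈ D, d z w = d w z
  triangle : ∀ x ∈ D, ∀ y ∈ D, ∀ z ∈ D, d x z ≤ d x y + d y z

/-- The Kobayashi pseudodistance `k_D`: the largest pseudodistance on `D` that does not exceed
the Lempert function, i.e. the pointwise supremum of all of them. -/
def kobayashi {n : ℕ} (D : Set (Cn n)) (z w : Cn n) : ℝ≥0∞ :=
  ⨆ (d : Cn n → Cn n → ℝ)
    (_ : IsPseudodistOn D d ∧ ∀ x ∈ D, ∀ y ∈ D, ENNReal.ofReal (d x y) ≤ lempert D x y),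
    ENNReal.ofReal (d z w)

end

/-! ### Tangent balls and the boundary distance -/

section Geometry

open Metric

/-! A `C^{1,1}` boundary has inner and outer tangent balls of one radius `R` near `p`. They make the
unit normal `ν` a Lipschitz field on `D` near `p`, equal to the gradient of the boundary distance.

Let `φ` be a disc in `D` with `φ 0 = x`, where `x` is near `p`. Boundedness and Schwarz give `|φ(ζ)
- x| ≤ B|ζ|`. The outer ball then bounds the real part of `-⟨φ - x, ν x⟩` by `Aρ²` on a disc of
radius `ρ ≳ √δ(x)`, and Borel–Carathéodory turns this one-sided bound into `|⟨φ(α) - x, ν x⟩| ≤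
C(|α|√δ(x) + |α|²)` (`norm_herm_le_of_touching`). Hence `√δ` grows at most linearly in `|α|`.

These estimates add up along chains of discs. Instead of chains, `exists_disc_contraction` uses a
potential `f`: the least `L` for which the accumulated bounds from `z` hold, capped at a constant.
It grows by at most `|α|` along a disc, so `|f x - f y|` is a pseudodistance below the Lempert
function, hence a competitor in the supremum defining `kobayashi`. Reading the bounds backwards
bounds `f w` from below. -/

theorem infDist_frontier_le_dist {E : Type*} [NormedAddCommGroup E] [NormedSpace ℝ E] {D : Set E}
    {x y : E} (hx : x ∈ D) (hy : y ∉ D) : infDist x (frontier D) ≤ dist x y := by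
  have key : (segment ℝ x y ∩ frontier D).Nonempty := by
    by_contra hne
    rw [Set.not_nonempty_iff_eq_empty, Set.eq_empty_iff_forall_notMem] at hne
    have hcov : segment ℝ x y ⊆ interior D ∪ (closure D)ᶜ := by
      intro t ht
      by_contra h
      rw [Set.mem_union, not_or, Set.mem_compl_iff, not_not] at h
      exact hne t ⟨ht, h.2, h.1⟩
    have hdisj : Disjoint (interior D) (closure D)ᶜ :=
      Set.disjoint_left.2 fun t ht ht' => ht' (interior_subset_closure ht)
    have hxi : x ∈ interior D := by
      rcases hcov (left_mem_segment ℝ x y) with h | h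
      · exact h
      · exact absurd (subset_closure hx) h
    have := (convex_segment x y).isPreconnected.subset_left_of_subset_union isOpen_interior
      isClosed_closure.isOpen_compl hdisj hcov ⟨x, left_mem_segment ℝ x y, hxi⟩
    exact hy (interior_subset (this (right_mem_segment ℝ x y)))
  obtain ⟨t, ht, htf⟩ := key
  refine (infDist_le_dist_of_mem htf).trans ?_
  have := dist_add_dist_of_mem_segment ht
  linarith [dist_nonneg (x := t) (y := y)]

theorem ball_infDist_frontier_subset {E : Type*} [NormedAddCommGroup E] [NormedSpace ℝ E]
    {D : Set E} {z : E} (hz : z ∈ D) : ball z (infDist z (frontier D)) ⊆ D := by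
  intro y hy
  by_contra hyD
  have := infDist_frontier_le_dist hz hyD
  rw [mem_ball, dist_comm] at hy
  linarith

variable {E : Type*} [NormedAddCommGroup E] [InnerProductSpace ℝ E]

/-- The two balls of radius `R` tangent at `q` to the hyperplane orthogonal to the unit vector `ν`
lie outside and inside `D` respectively. -/
structure TouchingBalls (D : Set E) (q ν : E) (R : ℝ) : Prop where
  norm_eq : ‖ν‖ = 1
  outer_le : ∀ x ∈ D, R ≤ ‖x - q + R • ν‖
  inner_subset : ball (q + R • ν) R ⊆ D

theorem norm_add_smul_unit_sq {ν : E} (hν : ‖ν‖ = 1) (u : E) (A : ℝ) :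
    ‖u + A • ν‖ ^ 2 = ‖u‖ ^ 2 + 2 * A * inner ℝ u ν + A ^ 2 := by
  rw [norm_add_sq_real, inner_smul_right, norm_smul, hν, Real.norm_eq_abs, mul_one, sq_abs]
  ring

/-- With `b = ⟨u, ν⟩` and `t = ‖u‖² / (2A)`, the squares of the two sides differ by exactly `(b +
t)²`. -/
theorem norm_add_smul_unit_le {ν : E} (hν : ‖ν‖ = 1) (u : E) {A : ℝ} (hA : 0 < A) :
    ‖u + A • ν‖ ≤ A + inner ℝ u ν + ‖u‖ ^ 2 / (2 * A) := by
  set b : ℝ := inner ℝ u ν with hb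
  have hbu : b ^ 2 ≤ ‖u‖ ^ 2 := by
    have h := abs_real_inner_le_norm u ν
    rw [hν, mul_one] at h
    exact sq_le_sq' (by linarith [(abs_le.1 h).1]) (abs_le.1 h).2
  obtain ⟨t, ht⟩ : ∃ t, t = ‖u‖ ^ 2 / (2 * A) := ⟨_, rfl⟩
  have htA : 2 * A * t = ‖u‖ ^ 2 := by rw [ht]; field_simp
  rw [← ht]
  apply le_of_sq_le_sq _ _
  · rw [norm_add_smul_unit_sq hν, ← hb]
    nlinarith [sq_nonneg (b + t)]
  · by_contra h
    push Not at h
    nlinarith [sq_nonneg (A + b)]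

namespace TouchingBalls

variable {D : Set E} {q ν z y : E} {R δ : ℝ}

theorem inner_ge (h : TouchingBalls D q ν R) (hR : 0 < R) (hy : y ∈ D) :
    -(‖y - q‖ ^ 2 / (2 * R)) ≤ inner ℝ (y - q) ν := by
  have h1 := h.outer_le y hy
  have h2 := norm_add_smul_unit_sq h.norm_eq (y - q) R
  rw [neg_le, ← sub_nonneg]
  have h3 : 0 ≤ ‖y - q‖ ^ 2 + 2 * R * inner ℝ (y - q) ν := by nlinarith
  have : ‖y - q‖ ^ 2 / (2 * R) - -inner ℝ (y - q) ν =
    (‖y - q‖ ^ 2 + 2 * R * inner ℝ (y - q) ν) / (2 * R) := by field_simp; ring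
  rw [this]; positivity

theorem infDist_add_le (h : TouchingBalls D q ν R) (hR : 0 < R) (hy : y ∈ D) :
    infDist y (frontier D) + R ≤ ‖y - q + R • ν‖ := by
  by_contra hlt
  push Not at hlt
  have hR' := h.outer_le y hy
  set c := q - R • ν with hc
  have hyc : y - q + R • ν = y - c := by rw [hc]; abel
  have hcD : c ∉ D := fun hcD => by
    have := h.outer_le c hcD
    rw [show c - q + R • ν = 0 by rw [hc]; abel, norm_zero] at this
    linarith
  have hle := infDist_frontier_le_dist hy hcD
  rw [dist_eq_norm] at hle
  rw [hyc] at hlt hR'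
  have hpos : 0 < ‖y - c‖ := by linarith
  obtain ⟨e, he⟩ : ∃ e, e = infDist y (frontier D) := ⟨_, rfl⟩
  rw [← he] at hlt hle
  -- Moving from `y` towards the outer centre `c` by the mean of `‖y - c‖ - R` and `e` stays in the
  -- ball of radius `e` about `y`, hence in `D`, yet enters the outer ball.
  obtain ⟨t, ht⟩ : ∃ t : ℝ, t = ((‖y - c‖ - R + e) / 2) / ‖y - c‖ := ⟨_, rfl⟩
  have htm : t * ‖y - c‖ = (‖y - c‖ - R + e) / 2 := by rw [ht]; field_simp
  have he0 : 0 ≤ e := he ▸ infDist_nonneg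
  have ht0 : 0 ≤ t := by rw [ht]; apply div_nonneg <;> linarith
  have hx : y - t • (y - c) ∈ D := by
    apply ball_infDist_frontier_subset hy
    rw [← he, mem_ball, dist_eq_norm]
    have : y - t • (y - c) - y = -(t • (y - c)) := by abel
    rw [this, norm_neg, norm_smul, Real.norm_of_nonneg ht0, htm]
    linarith
  have h2 := h.outer_le _ hx
  have h3 : y - t • (y - c) - q + R • ν = (1 - t) • (y - c) := by
    rw [hc, sub_smul, one_smul]; abel
  have ht1 : t ≤ 1 := by rw [ht, div_le_one hpos]; linarith
  rw [h3, norm_smul, Real.norm_of_nonneg (by linarith), sub_mul, one_mul, htm] at h2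
  linarith

/-- The point `z` is at distance at least `δ + R` from the outer centre, so the triangle inequality
through `q` is an equality and `z - q` points along `ν`. -/
theorem eq_add_smul (h : TouchingBalls D q ν R) (hR : 0 < R) (hz : z ∈ D)
    (hδ : infDist z (frontier D) = δ) (hδ0 : 0 < δ) (hq : dist z q = δ) : z = q + δ • ν := by
  have hzc := h.infDist_add_le hR hz
  have hsq := norm_add_smul_unit_sq h.norm_eq (z - q) R
  rw [dist_eq_norm] at hq
  rw [hq] at hsq
  rw [hδ] at hzc
  have hin : δ ≤ inner ℝ (z - q) ν := by
    have : (δ + R) ^ 2 ≤ ‖z - q + R • ν‖ ^ 2 := by gcongr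
    nlinarith
  have h0 : ‖z - q + (-δ) • ν‖ ^ 2 ≤ 0 := by
    rw [norm_add_smul_unit_sq h.norm_eq, hq]; nlinarith
  have h1 : ‖z - q + (-δ) • ν‖ = 0 := by nlinarith [norm_nonneg (z - q + (-δ) • ν)]
  rw [norm_eq_zero, neg_smul] at h1
  rw [← sub_eq_zero, ← h1]; abel

theorem infDist_le (h : TouchingBalls D q ν R) (hR : 0 < R) (hδ0 : 0 ≤ δ) (hzq : z = q + δ • ν)
    (hy : y ∈ D) :
    infDist y (frontier D) ≤ δ + inner ℝ (y - z) ν + ‖y - z‖ ^ 2 / (2 * R) := by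
  have h1 : y - q + R • ν = y - z + (R + δ) • ν := by rw [hzq, add_smul]; abel
  have h2 := norm_add_smul_unit_le h.norm_eq (y - z) (A := R + δ) (by linarith)
  have h3 : ‖y - z‖ ^ 2 / (2 * (R + δ)) ≤ ‖y - z‖ ^ 2 / (2 * R) := by gcongr; linarith
  have h4 := h.infDist_add_le hR hy
  rw [h1] at h4
  linarith

theorem le_infDist (h : TouchingBalls D q ν R) (hD : IsOpen D) (hne : (frontier D).Nonempty)
    (hδR : δ < R) (hzq : z = q + δ • ν) (y : E) :
    δ + inner ℝ (y - z) ν - ‖y - z‖ ^ 2 / (2 * (R - δ)) ≤ infDist y (frontier D) := by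
  rw [Metric.le_infDist hne]
  intro x hx
  have hxR : R ≤ ‖x - (q + R • ν)‖ := by
    by_contra hlt
    push Not at hlt
    rw [← dist_eq_norm] at hlt
    rw [hD.frontier_eq] at hx
    exact hx.2 (h.inner_subset hlt)
  have h2 := norm_add_smul_unit_le (ν := -ν) (by rw [norm_neg, h.norm_eq]) (y - z) (A := R - δ)
    (by linarith)
  have h3 : y - z + (R - δ) • -ν = (y - x) + (x - (q + R • ν)) := by
    rw [hzq, smul_neg, sub_smul]; abel
  have h4 : ‖x - (q + R • ν)‖ ≤ dist y x + ‖y - z + (R - δ) • -ν‖ := by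
    rw [h3, dist_eq_norm]
    have := norm_sub_le ((y - x) + (x - (q + R • ν))) (y - x)
    rw [add_sub_cancel_left] at this
    linarith
  rw [inner_neg_right] at h2
  linarith

/-- The outer and inner balls trap the distance between two quadratics with the same value and
gradient at `z`. -/
theorem hasFDerivAt_infDist (h : TouchingBalls D q ν R) (hD : IsOpen D)
    (hne : (frontier D).Nonempty) (hδ0 : 0 ≤ δ) (hδR : δ < R) (hz : z ∈ D)
    (hδ : infDist z (frontier D) = δ) (hzq : z = q + δ • ν) :
    HasFDerivAt (fun y => infDist y (frontier D)) (innerSL ℝ ν) z := by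
  have hbig : (fun y => infDist y (frontier D) - infDist z (frontier D) - innerSL ℝ ν (y - z))
      =O[𝓝 z] fun y => ‖y - z‖ ^ 2 := by
    refine Asymptotics.IsBigO.of_bound (1 / (2 * (R - δ))) ?_
    filter_upwards [hD.mem_nhds hz] with y hy
    have h1 := h.infDist_le (by linarith) hδ0 hzq hy
    have h2 := h.le_infDist hD hne hδR hzq y
    have h3 : ‖y - z‖ ^ 2 / (2 * R) ≤ ‖y - z‖ ^ 2 / (2 * (R - δ)) := by
      gcongr; linarith
    rw [innerSL_apply_apply, real_inner_comm, hδ, Real.norm_eq_abs, Real.norm_eq_abs,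
      abs_of_nonneg (sq_nonneg ‖y - z‖), one_div_mul_eq_div, abs_le]
    constructor <;> linarith
  refine HasFDerivAt.of_isLittleO (hbig.trans_isLittleO ?_)
  refine Asymptotics.isLittleO_norm_right.1 ?_
  have ht : Filter.Tendsto (fun y => ‖y - z‖) (𝓝 z) (𝓝 0) := by
    have : ContinuousAt (fun y => ‖y - z‖) z := by fun_prop
    simpa [ContinuousAt] using this
  have := (Asymptotics.isLittleO_one_iff ℝ).2 ht
  simpa [sq] using this.mul_isBigO (Asymptotics.isBigO_refl (fun y => ‖y - z‖) (𝓝 z))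

end TouchingBalls
end Geometry

/-! ### The Lipschitz normal field -/

section Geometry

open Metric

variable {E : Type*} [NormedAddCommGroup E] [InnerProductSpace ℝ E]

theorem norm_inv_norm_smul_sub_le {a b : E} (ha : a ≠ 0) (hb : b ≠ 0) :
    ‖‖a‖⁻¹ • a - ‖b‖⁻¹ • b‖ ≤ 2 * ‖a - b‖ / ‖a‖ := by
  have ha' : 0 < ‖a‖ := norm_pos_iff.2 ha
  have hb' : 0 < ‖b‖ := norm_pos_iff.2 hb
  have h1 : ‖a‖⁻¹ • a - ‖b‖⁻¹ • b = ‖a‖⁻¹ • (a - b) + (‖a‖⁻¹ - ‖b‖⁻¹) • b := by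
    rw [smul_sub, sub_smul]; abel
  have h2 : ‖(‖a‖⁻¹ - ‖b‖⁻¹) • b‖ ≤ ‖a - b‖ / ‖a‖ := by
    rw [norm_smul, Real.norm_eq_abs]
    have : |‖a‖⁻¹ - ‖b‖⁻¹| * ‖b‖ = |‖b‖ - ‖a‖| / ‖a‖ := by
      rw [inv_sub_inv ha'.ne' hb'.ne', abs_div, abs_of_pos (mul_pos ha' hb')]
      field_simp
    rw [this]
    gcongr
    rw [abs_sub_comm]
    exact abs_norm_sub_norm_le a b
  rw [h1]
  refine (norm_add_le _ _).trans ?_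
  rw [norm_smul, norm_inv, norm_norm]
  have : 2 * ‖a - b‖ / ‖a‖ = ‖a‖⁻¹ * ‖a - b‖ + ‖a - b‖ / ‖a‖ := by field_simp; ring
  rw [this]; gcongr

theorem abs_sub_sub_fderiv_le {s : E → ℝ} {c : E} {r K : ℝ} (hK : 0 ≤ K)
    (hs : ∀ x ∈ ball c r, DifferentiableAt ℝ s x)
    (hlip : ∀ x ∈ ball c r, ∀ y ∈ ball c r, ‖fderiv ℝ s x - fderiv ℝ s y‖ ≤ K * ‖x - y‖)
    {q x : E} (hq : q ∈ ball c r) (hx : x ∈ ball c r) :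
    |s x - s q - fderiv ℝ s q (x - q)| ≤ K * ‖x - q‖ ^ 2 := by
  have h := Convex.norm_image_sub_le_of_norm_fderiv_le' (𝕜 := ℝ) (f := s) (φ := fderiv ℝ s q)
    (C := K * ‖x - q‖) (s := ball c r ∩ closedBall q ‖x - q‖) (x := q) (y := x)
    (fun y hy => hs y hy.1) (fun y hy => ?_) ((convex_ball _ _).inter (convex_closedBall _ _))
    ⟨hq, mem_closedBall_self (norm_nonneg _)⟩ ⟨hx, by rw [mem_closedBall, dist_eq_norm]⟩
  · rw [Real.norm_eq_abs] at h
    rw [sq, ← mul_assoc]; exact h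
  · refine (hlip y hy.1 q hq).trans ?_
    have := hy.2
    rw [mem_closedBall, dist_eq_norm] at this
    gcongr

theorem exists_touchingBalls_of_lipschitz_fderiv [CompleteSpace E] {D V : Set E} {s : E → ℝ}
    {K : ℝ≥0} {p : E} (hD : IsOpen D) (hV : IsOpen V) (hpV : p ∈ V)
    (hs : DifferentiableOn ℝ s V) (hlip : LipschitzOnWith K (fderiv ℝ s) V)
    (hp : fderiv ℝ s p ≠ 0) (hDs : ∀ x ∈ V, x ∈ D ↔ s x < 0) :
    ∃ (N : E → E) (r R M : ℝ), 0 < r ∧ 0 < R ∧ 0 ≤ M ∧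
      (∀ q ∈ frontier D, q ∈ ball p r → TouchingBalls D q (N q) R) ∧
      ∀ x ∈ ball p r, ∀ y ∈ ball p r, ‖N x - N y‖ ≤ M * ‖x - y‖ := by
  obtain ⟨G, hG⟩ : ∃ G : E → E, G = fun x => (InnerProductSpace.toDual ℝ E).symm (fderiv ℝ s x) :=
    ⟨_, rfl⟩
  have hGi : ∀ x v, fderiv ℝ s x v = inner ℝ (G x) v := fun x v => by
    rw [hG, InnerProductSpace.toDual_symm_apply]
  have hGl : ∀ x ∈ V, ∀ y ∈ V, ‖fderiv ℝ s x - fderiv ℝ s y‖ ≤ K * ‖x - y‖ := fun x hx y hy => by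
    simpa [dist_eq_norm] using hlip.dist_le_mul x hx y hy
  have hGn : ∀ x y, ‖G x - G y‖ = ‖fderiv ℝ s x - fderiv ℝ s y‖ := fun x y => by
    rw [hG]; simp only [← map_sub, LinearIsometryEquiv.norm_map]
  obtain ⟨m, hm⟩ : ∃ m, m = ‖G p‖ / 2 := ⟨_, rfl⟩
  have hm0 : 0 < m := by
    rw [hm, hG]
    simpa using hp
  obtain ⟨r₀, hr₀, hr₀V⟩ := Metric.isOpen_iff.1 hV p hpV
  have hK0 : (0 : ℝ) ≤ K := K.2
  obtain ⟨ρ, hρ0, hρr, hρm⟩ : ∃ ρ : ℝ, 0 < ρ ∧ 2 * ρ ≤ r₀ ∧ K * (2 * ρ) ≤ m := by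
    refine ⟨min (r₀ / 2) (m / (2 * (K + 1))), by positivity, ?_, ?_⟩
    · linarith [min_le_left (r₀ / 2) (m / (2 * ((K : ℝ) + 1)))]
    · have h := min_le_right (r₀ / 2) (m / (2 * ((K : ℝ) + 1)))
      calc K * (2 * min (r₀ / 2) (m / (2 * ((K : ℝ) + 1))))
          ≤ (K + 1) * (2 * (m / (2 * ((K : ℝ) + 1)))) := by gcongr; linarith
        _ = m := by field_simp
  have hBV : ball p (2 * ρ) ⊆ V := (ball_subset_ball hρr).trans hr₀V
  have hGm : ∀ x ∈ ball p (2 * ρ), m ≤ ‖G x‖ := fun x hx => by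
    have h1 := hGl x (hBV hx) p hpV
    rw [← hGn] at h1
    have h2 : ‖x - p‖ ≤ 2 * ρ := by rw [← dist_eq_norm]; exact (mem_ball.1 hx).le
    have h3 := norm_sub_norm_le (G p) (G x)
    rw [norm_sub_rev] at h3
    have h4 : (K : ℝ) * ‖x - p‖ ≤ K * (2 * ρ) := by gcongr
    linarith
  have hsub : ball p ρ ⊆ ball p (2 * ρ) := ball_subset_ball (by linarith)
  have hdiff : ∀ x ∈ ball p (2 * ρ), DifferentiableAt ℝ s x := fun x hx =>
    (hs x (hBV hx)).differentiableAt (hV.mem_nhds (hBV hx))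
  -- Inside a tangent ball `‖u‖² < 2R|⟨u, ν⟩|`, so `2RK < m ≤ ‖∇s‖` lets the linear term of `s`
  -- dominate the Taylor remainder `K‖u‖²`.
  obtain ⟨R, hR0, hRρ, hRm⟩ : ∃ R : ℝ, 0 < R ∧ 2 * R ≤ ρ ∧ 2 * R * K < m := by
    refine ⟨min (ρ / 2) (m / (4 * (K + 1))), by positivity, ?_, ?_⟩
    · linarith [min_le_left (ρ / 2) (m / (4 * ((K : ℝ) + 1)))]
    · have h := min_le_right (ρ / 2) (m / (4 * ((K : ℝ) + 1)))
      calc 2 * min (ρ / 2) (m / (4 * ((K : ℝ) + 1))) * K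
          ≤ 2 * (m / (4 * ((K : ℝ) + 1))) * (K + 1) := by gcongr; linarith
        _ = m / 2 := by field_simp; ring
        _ < m := by linarith
  refine ⟨fun x => -(‖G x‖⁻¹ • G x), ρ, R, 2 * K / m, hρ0, hR0, by positivity, ?_, ?_⟩
  · intro q hqf hq
    have hqV := hBV (hsub hq)
    have hGq := hGm q (hsub hq)
    have hGq0 : 0 < ‖G q‖ := by linarith
    have hsq : s q = 0 := by
      rw [hD.frontier_eq] at hqf
      apply le_antisymm
      · have hcont : ContinuousAt s q := (hdiff q (hsub hq)).continuousAt
        by_contra hpos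
        push Not at hpos
        have hev := (hcont.eventually (lt_mem_nhds hpos)).and (hV.mem_nhds hqV)
        obtain ⟨x, hxD, hx⟩ := (mem_closure_iff_frequently.1 hqf.1).and_eventually hev |>.exists
        exact absurd ((hDs x hx.2).1 hxD) (not_lt.2 hx.1.le)
      · exact not_lt.1 fun h => hqf.2 ((hDs q hqV).2 h)
    have hν : ‖-(‖G q‖⁻¹ • G q)‖ = 1 := by
      rw [norm_neg, norm_smul, norm_inv, norm_norm, inv_mul_cancel₀ hGq0.ne']
    set ν := -(‖G q‖⁻¹ • G q) with hνdef
    have hGν : ∀ v, fderiv ℝ s q v = -(‖G q‖ * inner ℝ v ν) := fun v => by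
      rw [hGi, hνdef, inner_neg_right, inner_smul_right, real_inner_comm]
      field_simp
    have taylor : ∀ x, ‖x - q‖ < 2 * R →
        x ∈ V ∧ |s x + ‖G q‖ * inner ℝ (x - q) ν| ≤ K * ‖x - q‖ ^ 2 := fun x hx => by
      have hxb : x ∈ ball p (2 * ρ) := by
        rw [mem_ball]
        have := dist_triangle x q p
        rw [dist_eq_norm x q] at this
        have := mem_ball.1 hq
        linarith
      refine ⟨hBV hxb, ?_⟩
      have := abs_sub_sub_fderiv_le hK0 hdiff (fun x hx y hy => hGl x (hBV hx) y (hBV hy))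
        (hsub hq) hxb
      rw [hsq, hGν] at this
      convert this using 2
      ring
    -- The sign `ε = 1` is the outer ball, `ε = -1` the inner one.
    have hnear : ∀ u : E, ∀ ε : ℝ, ε = 1 ∨ ε = -1 → ‖u + (ε * R) • ν‖ < R →
        ‖u‖ < 2 * R ∧ ‖u‖ ^ 2 + 2 * (ε * R) * inner ℝ u ν < 0 := fun u ε hε hu => by
      have hε1 : |ε| = 1 := by rcases hε with rfl | rfl <;> simp
      have hε2 : ε ^ 2 = 1 := by rcases hε with rfl | rfl <;> simp
      constructor
      · have h1 := norm_sub_le (u + (ε * R) • ν) ((ε * R) • ν)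
        rw [add_sub_cancel_right, norm_smul, hν, mul_one, norm_mul, Real.norm_eq_abs,
          Real.norm_eq_abs, hε1, abs_of_pos hR0] at h1
        linarith
      · have h1 := norm_add_smul_unit_sq hν u (ε * R)
        have h2 : ‖u + (ε * R) • ν‖ ^ 2 < R ^ 2 := by gcongr
        rw [h1, mul_pow, hε2] at h2
        linarith
    refine ⟨hν, fun x hxD => ?_, fun x hx => ?_⟩
    · by_contra hlt
      push Not at hlt
      obtain ⟨h1, h2⟩ := hnear (x - q) 1 (Or.inl rfl) (by rwa [one_mul])
      obtain ⟨hxV, h3⟩ := taylor x h1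
      have h4 := (abs_le.1 h3).1
      have h5 := (hDs x hxV).1 hxD
      have h6 : 2 * R * (K * ‖x - q‖ ^ 2) ≤ ‖G q‖ * ‖x - q‖ ^ 2 := by
        have : 2 * R * K * ‖x - q‖ ^ 2 ≤ ‖G q‖ * ‖x - q‖ ^ 2 := by gcongr; linarith
        linarith
      have h7 : ‖G q‖ * (‖x - q‖ ^ 2 + 2 * (1 * R) * inner ℝ (x - q) ν) ≤ 0 :=
        mul_nonpos_of_nonneg_of_nonpos hGq0.le h2.le
      have h8 : 2 * R * s x < 0 := mul_neg_of_pos_of_neg (by linarith) h5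
      have h9 := mul_le_mul_of_nonneg_left h4 (by linarith : 0 ≤ 2 * R)
      linarith
    · rw [mem_ball, dist_eq_norm] at hx
      obtain ⟨h1, h2⟩ := hnear (x - q) (-1) (Or.inr rfl) (by
        rw [neg_one_mul, neg_smul, ← sub_eq_add_neg, sub_sub]; exact hx)
      obtain ⟨hxV, h3⟩ := taylor x h1
      have h4 := (abs_le.1 h3).2
      rw [hDs x hxV]
      have h6 : 2 * R * (K * ‖x - q‖ ^ 2) ≤ ‖G q‖ * ‖x - q‖ ^ 2 := by
        have : 2 * R * K * ‖x - q‖ ^ 2 ≤ ‖G q‖ * ‖x - q‖ ^ 2 := by gcongr; linarith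
        linarith
      have h7 : ‖G q‖ * (‖x - q‖ ^ 2 + 2 * (-1 * R) * inner ℝ (x - q) ν) < 0 :=
        mul_neg_of_pos_of_neg hGq0 h2
      have h9 := mul_le_mul_of_nonneg_left h4 (by linarith : 0 ≤ 2 * R)
      by_contra h10
      push Not at h10
      have h11 : 0 ≤ 2 * R * s x := by positivity
      linarith
  · intro x hx y hy
    have hx' := hGm x (hsub hx)
    have hy' := hGm y (hsub hy)
    have h := norm_inv_norm_smul_sub_le (a := G x) (b := G y) (norm_pos_iff.1 (by linarith))
      (norm_pos_iff.1 (by linarith))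
    rw [neg_sub_neg, norm_sub_rev]
    refine h.trans ?_
    rw [hGn]
    calc 2 * ‖fderiv ℝ s x - fderiv ℝ s y‖ / ‖G x‖ ≤ 2 * (K * ‖x - y‖) / m := by
          gcongr
          exact hGl x (hBV (hsub hx)) y (hBV (hsub hy))
      _ = 2 * K / m * ‖x - y‖ := by ring

/-- Near a `C^{1,1}` boundary point there is a Lipschitz field of inner unit normals, which is the
gradient of the boundary distance. -/
theorem exists_normal_field [ProperSpace E] {D : Set E} (hD : IsOpen D) {p : E}
    (hp : p ∈ frontier D) {N : E → E} {r R M : ℝ} (hr : 0 < r) (hR : 0 < R) (hM : 0 ≤ M)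
    (hN : ∀ q ∈ frontier D, q ∈ ball p r → TouchingBalls D q (N q) R)
    (hlip : ∀ x ∈ ball p r, ∀ y ∈ ball p r, ‖N x - N y‖ ≤ M * ‖x - y‖) :
    ∃ (n : E → E) (r' M' : ℝ), 0 < r' ∧ r' ≤ 1 ∧ 0 ≤ M' ∧
      (∀ z ∈ D ∩ ball p r', infDist z (frontier D) ≤ r' ∧ 0 < infDist z (frontier D) ∧
        (∃! q, q ∈ frontier D ∧ dist z q = infDist z (frontier D)) ∧
        HasFDerivAt (fun y => infDist y (frontier D)) (innerSL ℝ (n z)) z ∧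
        ∃ q, z = q + infDist z (frontier D) • n z ∧ TouchingBalls D q (n z) R) ∧
      ∀ x ∈ D ∩ ball p r', ∀ y ∈ D ∩ ball p r', ‖n x - n y‖ ≤ M' * ‖x - y‖ := by
  have hne : (frontier D).Nonempty := ⟨p, hp⟩
  have hproj : ∀ z, ∃ q ∈ frontier D, infDist z (frontier D) = dist z q := fun z =>
    isClosed_frontier.exists_infDist_eq_dist hne z
  choose π hπf hπd using hproj
  obtain ⟨r', hr'0, hr'1, hr'r, hr'R, hr'M⟩ : ∃ r' : ℝ, 0 < r' ∧ r' ≤ 1 ∧ 2 * r' ≤ r ∧ r' < R ∧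
      2 * (r' * M) ≤ 1 := by
    refine ⟨min (min 1 (r / 2)) (min (R / 2) (1 / (2 * (M + 1)))), by positivity, ?_, ?_, ?_, ?_⟩
    · exact (min_le_left _ _).trans (min_le_left _ _)
    · have := (min_le_left (min 1 (r / 2)) (min (R / 2) (1 / (2 * (M + 1))))).trans
        (min_le_right _ _)
      linarith
    · have := (min_le_right (min 1 (r / 2)) (min (R / 2) (1 / (2 * (M + 1))))).trans
        (min_le_left _ _)
      linarith
    · have := (min_le_right (min 1 (r / 2)) (min (R / 2) (1 / (2 * (M + 1))))).trans
        (min_le_right _ _)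
      calc _ ≤ 2 * (1 / (2 * (M + 1)) * (M + 1)) := by gcongr; linarith
        _ = 1 := by field_simp
  have hδr : ∀ z ∈ D ∩ ball p r', infDist z (frontier D) < r' := fun z hz =>
    (infDist_le_dist_of_mem hp).trans_lt hz.2
  have hδ0 : ∀ z ∈ D ∩ ball p r', 0 < infDist z (frontier D) := fun z hz => by
    refine (isClosed_frontier.notMem_iff_infDist_pos hne).1 fun h => ?_
    rw [hD.frontier_eq] at h
    exact h.2 hz.1
  have hqr : ∀ z ∈ D ∩ ball p r', ∀ q, dist z q = infDist z (frontier D) → q ∈ ball p r :=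
    fun z hz q hq => by
      have h1 := dist_triangle q z p
      rw [dist_comm q z, hq] at h1
      have := hδr z hz
      have := mem_ball.1 hz.2
      rw [mem_ball]; linarith
  have hT : ∀ z ∈ D ∩ ball p r', TouchingBalls D (π z) (N (π z)) R := fun z hz =>
    hN _ (hπf z) (hqr z hz _ (hπd z).symm)
  have hzπ : ∀ z ∈ D ∩ ball p r', z = π z + infDist z (frontier D) • N (π z) := fun z hz =>
    (hT z hz).eq_add_smul hR hz.1 rfl (hδ0 z hz) (hπd z).symm
  have hfd : ∀ z ∈ D ∩ ball p r', ∀ q ∈ frontier D, dist z q = infDist z (frontier D) →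
      z = q + infDist z (frontier D) • N q ∧
      HasFDerivAt (fun y => infDist y (frontier D)) (innerSL ℝ (N q)) z := fun z hz q hq hd => by
    have h1 := hN q hq (hqr z hz q hd)
    have h2 := h1.eq_add_smul hR hz.1 rfl (hδ0 z hz) hd
    exact ⟨h2, h1.hasFDerivAt_infDist hD hne (hδ0 z hz).le ((hδr z hz).trans hr'R) hz.1 rfl h2⟩
  refine ⟨fun z => N (π z), r', 4 * M, hr'0, hr'1, by positivity, fun z hz => ⟨(hδr z hz).le,
    hδ0 z hz, ⟨π z, ⟨hπf z, (hπd z).symm⟩, fun q hq => ?_⟩,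
    (hfd z hz _ (hπf z) (hπd z).symm).2, π z, hzπ z hz, hT z hz⟩, fun x hx y hy => ?_⟩
  -- The normal at any nearest point is the gradient at `z`; uniqueness of the derivative identifies
  -- the normals, hence the nearest points.
  · obtain ⟨h1, h2⟩ := hfd z hz q hq.1 hq.2
    obtain ⟨h3, h4⟩ := hfd z hz _ (hπf z) (hπd z).symm
    have h5 : N q = N (π z) := by
      have := congrArg (fun L => L (N q - N (π z))) (h2.unique h4)
      simp only [innerSL_apply_apply] at this
      rw [← sub_eq_zero, ← inner_self_eq_zero (𝕜 := ℝ), inner_sub_left, sub_eq_zero]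
      exact this
    have h6 := h1.symm.trans h3
    rw [h5] at h6
    exact add_right_cancel h6
  · have hl := hlip _ (hqr x hx _ (hπd x).symm) _ (hqr y hy _ (hπd y).symm)
    set δx := infDist x (frontier D) with hδx
    set δy := infDist y (frontier D) with hδy
    have h1 : π x - π y = (x - y) - (δx - δy) • N (π y) - δx • (N (π x) - N (π y)) := by
      have e1 : π x = x - δx • N (π x) := eq_sub_of_add_eq (hzπ x hx).symm
      have e2 : π y = y - δy • N (π y) := eq_sub_of_add_eq (hzπ y hy).symm
      nth_rewrite 1 [e1]
      nth_rewrite 1 [e2]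
      rw [sub_smul, smul_sub]; abel
    have h2 : |δx - δy| ≤ ‖x - y‖ := by
      rw [← dist_eq_norm, ← Real.dist_eq]
      simpa using (lipschitz_infDist_pt (frontier D)).dist_le_mul x y
    -- Since `r' * M ≤ 1/2`, the last term is absorbed on the left.
    have h3 : ‖π x - π y‖ ≤ ‖x - y‖ + ‖x - y‖ + r' * (M * ‖π x - π y‖) := by
      nth_rewrite 1 [h1]
      refine (norm_sub_le _ _).trans (add_le_add ((norm_sub_le _ _).trans ?_) ?_)
      · rw [norm_smul, (hT y hy).norm_eq, mul_one, Real.norm_eq_abs]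
        gcongr
      · rw [norm_smul, Real.norm_of_nonneg (hδ0 x hx).le]
        gcongr
        exact (hδr x hx).le
    have h4 : 2 * (r' * M) * ‖π x - π y‖ ≤ 1 * ‖π x - π y‖ := by gcongr
    have h5 : ‖π x - π y‖ ≤ 4 * ‖x - y‖ := by linarith
    calc _ ≤ M * ‖π x - π y‖ := hl
      _ ≤ M * (4 * ‖x - y‖) := by gcongr
      _ = _ := by ring

end Geometry

/-! ### Estimates along one analytic disc -/

section Discs

open Metric

theorem inner_real_eq_re_herm {n : ℕ} (x y : Cn n) : inner ℝ x y = (herm x y).re := by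
  simp only [herm, PiLp.inner_apply, Complex.inner, Complex.re_sum, Complex.mul_re,
    Complex.conj_re, Complex.conj_im]
  exact Finset.sum_congr rfl fun _ _ => by ring

theorem herm_eq_inner {n : ℕ} (x y : Cn n) : herm x y = inner ℂ y x := by
  simp [herm, PiLp.inner_apply]

theorem norm_herm_le {n : ℕ} (x y : Cn n) : ‖herm x y‖ ≤ ‖x‖ * ‖y‖ := by
  rw [herm_eq_inner, mul_comm]; exact norm_inner_le_norm y x

theorem norm_herm_le_of_touching {n : ℕ} {D : Set (Cn n)} {q ν x : Cn n} {δ R B : ℝ}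
    (hB : 0 < B) (hDB : ∀ x ∈ D, ∀ y ∈ D, ‖y - x‖ ≤ B) (hR : 0 < R)
    (hT : TouchingBalls D q ν R) (hδ0 : 0 < δ) (hδ1 : δ ≤ 1) (hx : x = q + δ • ν)
    {φ : ℂ → Cn n} {α : ℂ} (hφ : DifferentiableOn ℂ φ (ball 0 1))
    (hφD : Set.MapsTo φ (ball 0 1) D) (hα : α ∈ ball (0 : ℂ) 1) (hφ0 : φ 0 = x) :
    ‖φ α - x‖ ≤ B * ‖α‖ ∧
      ‖herm (φ α - x) ν‖ ≤ (8 * (4 + (2 + B) ^ 2 / (2 * R)) + 4 * B) *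
        (‖α‖ * √δ + ‖α‖ ^ 2) := by
  have h0 : (0 : ℂ) ∈ ball (0 : ℂ) 1 := mem_ball_self one_pos
  have hxD : x ∈ D := hφ0 ▸ hφD h0
  have hlin : ∀ ζ ∈ ball (0 : ℂ) 1, ‖φ ζ - x‖ ≤ B * ‖ζ‖ := fun ζ hζ => by
    have := Complex.dist_le_div_mul_dist_of_mapsTo_ball (f := φ) (c := 0) (R₁ := 1) (R₂ := B) hφ
      (fun y hy => by
        rw [mem_closedBall, dist_eq_norm, hφ0]
        exact hDB _ hxD _ (hφD hy)) hζ
    simpa [dist_eq_norm, hφ0] using this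
  refine ⟨hlin α hα, ?_⟩
  obtain ⟨e, he⟩ : ∃ e, e = √δ := ⟨_, rfl⟩
  have he0 : 0 < e := by rw [he]; positivity
  have he1 : e ≤ 1 := by rw [he]; exact Real.sqrt_le_one.2 hδ1
  have heδ : δ = e ^ 2 := by rw [he, Real.sq_sqrt hδ0.le]
  rw [← he]
  obtain ⟨A, hA⟩ : ∃ A, A = 4 + (2 + B) ^ 2 / (2 * R) := ⟨_, rfl⟩
  have hA0 : 0 < A := by rw [hA]; positivity
  rw [← hA]
  obtain ⟨a, ha⟩ : ∃ a, a = ‖α‖ := ⟨_, rfl⟩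
  have ha0 : 0 ≤ a := ha ▸ norm_nonneg α
  have hg : ‖herm (φ α - x) ν‖ ≤ B * a := by
    have := norm_herm_le (φ α - x) ν
    rw [hT.norm_eq, mul_one] at this
    rw [ha]
    exact this.trans (hlin α hα)
  rw [← ha]
  -- For `a > 1/4` the Schwarz bound is already quadratic in `a`.
  rcases lt_or_ge (1 / 4) a with h | h
  · refine hg.trans ?_
    have h1 : B * a ≤ B * (4 * a ^ 2) := by gcongr; nlinarith
    have h2 : 0 ≤ 4 * B * (a * e) := by positivity
    have h3 : 0 ≤ 8 * A * (a * e + a ^ 2) := by positivity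
    linarith
  -- This radius gives `ρ ≤ 1`, `ρ - a ≥ ρ / 2` and `δ ≤ 4ρ²`, while `aρ` is still of order `a√δ +
  -- a²`.
  · obtain ⟨ρ, hρ⟩ : ∃ ρ, ρ = 2 * a + e / 2 := ⟨_, rfl⟩
    have hρ0 : 0 < ρ := by linarith
    have hρ1 : ρ ≤ 1 := by linarith
    have haρ : a < ρ := by linarith
    have hsub : ball (0 : ℂ) ρ ⊆ ball 0 1 := ball_subset_ball hρ1
    have hre : Set.MapsTo (fun ζ => -herm (φ ζ - x) ν) (ball 0 ρ) {w | w.re ≤ A * ρ ^ 2} := by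
      intro ζ hζ
      rw [Set.mem_ofPred_eq, Complex.neg_re, ← inner_real_eq_re_herm]
      have h1 := hT.inner_ge hR (hφD (hsub hζ))
      have hνν : inner ℝ ν ν = (1 : ℝ) := by
        rw [real_inner_self_eq_norm_sq, hT.norm_eq, one_pow]
      have h2 : inner ℝ (φ ζ - x) ν = inner ℝ (φ ζ - q) ν - δ := by
        rw [hx, ← sub_sub, inner_sub_left, real_inner_smul_left, hνν, mul_one]
      have h3 : ‖φ ζ - q‖ ≤ (2 + B) * ρ := by
        have e1 : φ ζ - q = (φ ζ - x) + δ • ν := by rw [hx]; abel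
        rw [e1]
        refine (norm_add_le _ _).trans ?_
        rw [norm_smul, hT.norm_eq, mul_one, Real.norm_of_nonneg hδ0.le]
        have h4 := hlin ζ (hsub hζ)
        have h5 : B * ‖ζ‖ ≤ B * ρ := by
          gcongr
          exact (mem_ball_zero_iff.1 hζ).le
        have h6 : δ ≤ 2 * ρ := by nlinarith
        linarith
      have h4 : ‖φ ζ - q‖ ^ 2 / (2 * R) ≤ ((2 + B) * ρ) ^ 2 / (2 * R) := by gcongr
      have h5 : δ ≤ 4 * ρ ^ 2 := by nlinarith
      rw [h2, hA]
      have h6 : (4 + (2 + B) ^ 2 / (2 * R)) * ρ ^ 2 = 4 * ρ ^ 2 + ((2 + B) * ρ) ^ 2 / (2 * R) := by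
        ring
      rw [h6]; linarith
    have hdiff : DifferentiableOn ℂ (fun ζ => -herm (φ ζ - x) ν) (ball 0 ρ) := by
      simp only [herm_eq_inner]
      have h1 : DifferentiableOn ℂ (fun ζ => (innerSL ℂ ν) (φ ζ - x)) (ball 0 ρ) :=
        (innerSL ℂ ν).differentiable.comp_differentiableOn ((hφ.mono hsub).sub_const x)
      exact h1.neg
    have hbc := Complex.borelCaratheodory_zero (z := α) (by positivity) hdiff hre hρ0
      (by rw [mem_ball_zero_iff, ← ha]; exact haρ) (by simp [hφ0, herm])
    rw [norm_neg, ← ha] at hbc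
    refine hbc.trans ?_
    rw [div_le_iff₀ (by linarith)]
    have h1 : ρ / 2 ≤ ρ - a := by linarith
    have h2 : (4 * A * ρ * a) * (ρ / 2) ≤ (4 * A * ρ * a) * (ρ - a) := by gcongr
    have h3 : 4 * A * ρ * a ≤ (8 * A + 4 * B) * (a * e + a ^ 2) := by
      have e1 : 4 * A * ρ * a = 8 * A * (a ^ 2) + 2 * A * (a * e) := by rw [hρ]; ring
      have e2 : 0 ≤ 4 * B * (a * e + a ^ 2) := by positivity
      have e3 : 0 ≤ 6 * A * (a * e) := by positivity
      rw [e1]; linarith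
    have h4 : 4 * A * ρ * a * (ρ - a) ≤ (8 * A + 4 * B) * (a * e + a ^ 2) * (ρ - a) := by
      gcongr
    linarith

/-- `φ` is an analytic disc in `D` from `φ 0 = x` to `φ α = y`. -/
def IsDiscJoining {n : ℕ} (D : Set (Cn n)) (x y : Cn n) (φ : ℂ → Cn n) (α : ℂ) : Prop :=
  DifferentiableOn ℂ φ (ball 0 1) ∧ Set.MapsTo φ (ball 0 1) D ∧ α ∈ ball (0 : ℂ) 1 ∧
    φ 0 = x ∧ φ α = y

/-- Precompose with the disc involution exchanging `0` and `α`. -/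
theorem IsDiscJoining.reverse {n : ℕ} {D : Set (Cn n)} {x y : Cn n} {φ : ℂ → Cn n} {α : ℂ}
    (h : IsDiscJoining D x y φ α) :
    IsDiscJoining D y x (fun ζ => φ ((α - ζ) / (1 - starRingEnd ℂ α * ζ))) α := by
  obtain ⟨h1, h2, h3, h4, h5⟩ := h
  have hα : Complex.normSq α < 1 := by
    rw [Complex.normSq_eq_norm_sq]
    have := mem_ball_zero_iff.1 h3
    nlinarith [norm_nonneg α]
  have key : ∀ ζ ∈ ball (0 : ℂ) 1,
      Complex.normSq (α - ζ) < Complex.normSq (1 - starRingEnd ℂ α * ζ) := fun ζ hζ => by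
    have hζ' : Complex.normSq ζ < 1 := by
      rw [Complex.normSq_eq_norm_sq]
      have := mem_ball_zero_iff.1 hζ
      nlinarith [norm_nonneg ζ]
    have := mul_pos (sub_pos.2 hα) (sub_pos.2 hζ')
    simp only [Complex.normSq_apply, Complex.sub_re, Complex.sub_im, Complex.mul_re,
      Complex.mul_im, Complex.conj_re, Complex.conj_im, Complex.one_re, Complex.one_im] at this ⊢
    nlinarith
  have hne : ∀ ζ ∈ ball (0 : ℂ) 1, 1 - starRingEnd ℂ α * ζ ≠ 0 := fun ζ hζ h0 => by
    have := key ζ hζ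
    rw [h0, map_zero] at this
    exact absurd this (not_lt.2 (Complex.normSq_nonneg _))
  have hmaps : Set.MapsTo (fun ζ => (α - ζ) / (1 - starRingEnd ℂ α * ζ)) (ball 0 1)
      (ball (0 : ℂ) 1) := fun ζ hζ => by
    have h6 : 0 < ‖1 - starRingEnd ℂ α * ζ‖ := norm_pos_iff.2 (hne ζ hζ)
    rw [mem_ball_zero_iff, norm_div, div_lt_one h6]
    have := key ζ hζ
    rw [Complex.normSq_eq_norm_sq, Complex.normSq_eq_norm_sq] at this
    exact lt_of_pow_lt_pow_left₀ 2 h6.le this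
  refine ⟨h1.comp ?_ hmaps, fun ζ hζ => h2 (hmaps hζ), h3, by simp [h5], by simp [h4]⟩
  exact DifferentiableOn.div (by fun_prop) (by fun_prop) hne

theorem self_le_artanh {x : ℝ} (h0 : 0 ≤ x) (h1 : x < 1) : x ≤ Real.artanh x := by
  have h := Real.sum_range_le_log_div h0 h1 1
  rw [Real.artanh_eq_half_log ⟨by linarith, h1.le⟩]
  simpa using h

/-- Reversing discs makes the one-sided hypothesis symmetric, and `|α| ≤ artanh |α|`. -/
theorem ofReal_abs_sub_le_kobayashi {n : ℕ} {D : Set (Cn n)} {f : Cn n → ℝ}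
    (hf : ∀ x y φ α, IsDiscJoining D x y φ α → f y ≤ f x + ‖α‖) (z w : Cn n) :
    ENNReal.ofReal |f z - f w| ≤ kobayashi D z w := by
  refine le_iSup₂_of_le (fun x y => |f x - f y|) ⟨⟨fun _ _ _ _ => abs_nonneg _,
    fun _ _ => by simp, fun _ _ _ _ => abs_sub_comm _ _, fun _ _ _ _ _ _ => abs_sub_le _ _ _⟩,
    fun x _ y _ => ?_⟩ le_rfl
  refine le_iInf fun φ => le_iInf fun α => le_iInf fun h => ENNReal.ofReal_le_ofReal ?_
  have h' : IsDiscJoining D x y φ α := h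
  have h1 := hf x y φ α h'
  have h2 := hf y x _ α h'.reverse
  have h3 := self_le_artanh (norm_nonneg α) (mem_ball_zero_iff.1 h.2.2.1)
  rw [abs_le]
  constructor <;> linarith

end Discs

/-! ### The potential and elementary inequalities -/

section Potential

open Metric

theorem herm_sub_left {n : ℕ} (x y ν : Cn n) : herm (x - y) ν = herm x ν - herm y ν := by
  simp only [herm_eq_inner, inner_sub_right]

theorem herm_sub_right {n : ℕ} (x μ ν : Cn n) : herm x (μ - ν) = herm x μ - herm x ν := by
  simp only [herm_eq_inner, inner_sub_left]

theorem normalComp_eq_herm {n : ℕ} {D : Set (Cn n)} {z ν : Cn n}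
    (h : HasFDerivAt (bdryDist D) (innerSL ℝ ν) z) (X : Cn n) :
    normalComp D z X = herm X ν := by
  have hν : dbarBdryDist D z = (1 / 2 : ℂ) • ν := by
    ext j
    simp only [dbarBdryDist, h.fderiv, innerSL_apply_apply, inner_real_eq_re_herm, herm,
      PiLp.smul_apply, smul_eq_mul]
    congr 1
    apply Complex.ext <;> simp [apply_ite]
  rw [normalComp, hν, herm, herm, Finset.mul_sum]
  refine Finset.sum_congr rfl fun j _ => ?_
  simp only [PiLp.smul_apply, smul_eq_mul, map_mul, map_div₀, map_one, Complex.conj_ofNat]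
  ring

/-- The one-disc bounds propagate along chains of discs: a function measuring the distance from
`z` in these bounds is a contraction along every disc. -/
theorem exists_disc_contraction {n : ℕ} {D : Set (Cn n)} {p z : Cn n} {ν : Cn n → Cn n}
    {r C₁ C₂ C₃ M : ℝ} (hr : 0 < r) (hC₁ : 0 < C₁) (hC₂ : 0 ≤ C₂) (hC₃ : 0 ≤ C₃) (hM : 0 ≤ M)
    (hz : z ∈ D ∩ ball p (r / 2))
    (hlip : ∀ x ∈ D ∩ ball p r, ∀ y ∈ D ∩ ball p r, ‖ν x - ν y‖ ≤ M * ‖x - y‖)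
    (hlin : ∀ x y φ α, IsDiscJoining D x y φ α → ‖y - x‖ ≤ C₁ * ‖α‖)
    (hnorm : ∀ x y φ α, x ∈ ball p r → IsDiscJoining D x y φ α →
      ‖herm (y - x) (ν x)‖ ≤ C₂ * (‖α‖ * √(bdryDist D x) + ‖α‖ ^ 2))
    (hsqrt : ∀ x y φ α, x ∈ ball p r → IsDiscJoining D x y φ α →
      √(bdryDist D y) ≤ √(bdryDist D x) + C₃ * ‖α‖) :
    ∃ f : Cn n → ℝ, f z = 0 ∧ (∀ x y φ α, IsDiscJoining D x y φ α → f y ≤ f x + ‖α‖) ∧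
      ∀ w m, m ≤ r / (2 * C₁) → (∀ L, 0 ≤ L → ‖w - z‖ ≤ C₁ * L →
        √(bdryDist D w) ≤ √(bdryDist D z) + C₃ * L →
        ‖herm (w - z) (ν z)‖ ≤ (C₂ + C₂ * C₃ + C₁ ^ 2 * M) * (L * √(bdryDist D z) + L ^ 2) →
          m ≤ L) → m ≤ f w := by
  obtain ⟨C₄, hC₄⟩ : ∃ C₄, C₄ = C₂ + C₂ * C₃ + C₁ ^ 2 * M := ⟨_, rfl⟩
  obtain ⟨e, he⟩ : ∃ e, e = √(bdryDist D z) := ⟨_, rfl⟩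
  obtain ⟨ε, hε⟩ : ∃ ε, ε = r / (2 * C₁) := ⟨_, rfl⟩
  have he0 : 0 ≤ e := he ▸ Real.sqrt_nonneg _
  have hε0 : 0 < ε := by rw [hε]; positivity
  have hCε : C₁ * ε = r / 2 := by rw [hε]; field_simp
  rw [← hC₄, ← he, ← hε]
  obtain ⟨P, hP⟩ : ∃ P : Cn n → ℝ → Prop, P = fun y L => ‖y - z‖ ≤ C₁ * L ∧
    √(bdryDist D y) ≤ e + C₃ * L ∧ ‖herm (y - z) (ν z)‖ ≤ C₄ * (L * e + L ^ 2) := ⟨_, rfl⟩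
  -- The cap `ε` keeps the infimum finite and makes the disc estimates necessary only for `L ≤ ε`;
  -- since `C₁ * ε = r / 2`, such points stay in `ball p r`.
  obtain ⟨S, hS⟩ : ∃ S : Cn n → Set ℝ, ∀ y L, L ∈ S y ↔ (0 ≤ L ∧ L ≤ ε ∧ P y L) ∨ L = ε :=
    ⟨fun y => {L | (0 ≤ L ∧ L ≤ ε ∧ P y L) ∨ L = ε}, fun _ _ => Iff.rfl⟩
  have hSne : ∀ y, (S y).Nonempty := fun y => ⟨ε, (hS y ε).2 (Or.inr rfl)⟩
  have hS0 : ∀ y, ∀ L ∈ S y, 0 ≤ L := fun y L hL => by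
    rcases (hS y L).1 hL with h | h
    · exact h.1
    · exact h ▸ hε0.le
  have hSb : ∀ y, BddBelow (S y) := fun y => ⟨0, hS0 y⟩
  have hstep : ∀ x y φ α, IsDiscJoining D x y φ α → ∀ L, 0 ≤ L → L + ‖α‖ ≤ ε → P x L →
      P y (L + ‖α‖) := fun x y φ α hd L hL0 hLε hPx => by
    rw [hP] at hPx ⊢
    obtain ⟨h1, h2, h3⟩ := hPx
    obtain ⟨a, ha⟩ : ∃ a, a = ‖α‖ := ⟨_, rfl⟩
    have ha0 : 0 ≤ a := ha ▸ norm_nonneg α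
    have hxD : x ∈ D := hd.2.2.2.1 ▸ hd.2.1 (mem_ball_self one_pos)
    have hxz : C₁ * L ≤ r / 2 := by
      rw [← hCε]; gcongr; linarith
    have hzr := mem_ball.1 hz.2
    have hxp : x ∈ ball p r := by
      rw [mem_ball]
      have := dist_triangle x z p
      rw [dist_eq_norm x z] at this
      linarith
    have hzp : z ∈ ball p r := by rw [mem_ball]; linarith
    have g1 := hlin x y φ α hd
    have g2 := hsqrt x y φ α hxp hd
    have g3 := hnorm x y φ α hxp hd
    have g4 := hlip z ⟨hz.1, hzp⟩ x ⟨hxD, hxp⟩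
    rw [← ha] at g1 g2 g3 ⊢
    refine ⟨?_, by linarith, ?_⟩
    · have : y - z = (y - x) + (x - z) := by abel
      rw [this]
      exact (norm_add_le _ _).trans (by linarith)
    -- Replacing `ν z` by `ν x` costs a multiple of `aL`, as does replacing `√δ(x)` by `e`; both fit
    -- into the cross term of `C₄(L + a)²`.
    · have hdec : herm (y - z) (ν z) =
          herm (x - z) (ν z) + herm (y - x) (ν x) + herm (y - x) (ν z - ν x) := by
        rw [herm_sub_right, herm_sub_left y z, herm_sub_left x z, herm_sub_left y x (ν z)]; ring
      have k1 : ‖herm (y - x) (ν z - ν x)‖ ≤ C₁ * a * (M * (C₁ * L)) := by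
        refine (norm_herm_le _ _).trans ?_
        gcongr
        refine g4.trans ?_
        rw [norm_sub_rev]
        gcongr
      have k2 : C₂ * (a * √(bdryDist D x) + a ^ 2) ≤ C₂ * (a * (e + C₃ * L) + a ^ 2) := by
        gcongr
      rw [hdec]
      refine (norm_add₃_le).trans ?_
      have k3 : 0 ≤ C₂ * C₃ * (a * e + a ^ 2 + a * L) := by positivity
      have k4 : 0 ≤ C₁ ^ 2 * M * (a * e + a ^ 2 + a * L) := by positivity
      have k5 : 0 ≤ C₂ * (a * L) := by positivity
      have k6 : C₄ * ((L + a) * e + (L + a) ^ 2) - C₄ * (L * e + L ^ 2) =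
        C₂ * (a * (e + C₃ * L) + a ^ 2) + C₁ * a * (M * (C₁ * L)) + 2 * (C₂ * (a * L))
          + C₂ * C₃ * (a * e + a ^ 2 + a * L) + C₁ ^ 2 * M * (a * e + a ^ 2 + a * L) := by
        rw [hC₄]; ring
      linarith
  refine ⟨fun y => sInf (S y), ?_, fun x y φ α hd => ?_, fun w m hm hw => ?_⟩
  · refine le_antisymm (csInf_le (hSb z) ((hS z 0).2 (Or.inl ⟨le_rfl, hε0.le, ?_⟩)))
      (le_csInf (hSne z) (hS0 z))
    rw [hP]
    simp [he, herm]
  · rw [← sub_le_iff_le_add]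
    refine le_csInf (hSne x) fun L hL => ?_
    rw [sub_le_iff_le_add]
    rcases le_or_gt (L + ‖α‖) ε with h | h
    · rcases (hS x L).1 hL with h1 | h1
      · exact csInf_le (hSb y) ((hS y _).2 (Or.inl ⟨by linarith [norm_nonneg α], h,
          hstep x y φ α hd L h1.1 h h1.2.2⟩))
      · refine (csInf_le (hSb y) ((hS y ε).2 (Or.inr rfl))).trans ?_
        linarith [norm_nonneg α]
    · exact (csInf_le (hSb y) ((hS y ε).2 (Or.inr rfl))).trans h.le
  · refine le_csInf (hSne w) fun L hL => ?_
    rcases (hS w L).1 hL with ⟨h1, -, h2⟩ | h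
    · rw [hP] at h2
      exact hw L h1 h2.1 h2.2.1 h2.2.2
    · rw [h]; exact hm

/-- If `L ≤ √a + e`, then `Le + L² ≤ 2L(√a + e)`; otherwise `√a ≤ L`, so `a ≤ L√a`. This produces
the quotient in `HD`. -/
theorem div_sqrt_add_le {a t e L C : ℝ} (ha : 0 ≤ a) (ht : 0 ≤ t) (he : 0 ≤ e) (hL : 0 ≤ L)
    (hC : 0 ≤ C) (h : a ≤ C * (L * e + L ^ 2)) : a / (√a + t + e) ≤ (2 * C + 1) * L := by
  have hs := Real.sqrt_nonneg a
  refine div_le_of_le_mul₀ (by positivity) (by positivity) ?_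
  rcases le_total L (√a + e) with h1 | h1
  · have h2 : C * (L * e + L ^ 2) ≤ C * (L * (√a + e) + L * (√a + e)) := by
      rw [sq]; gcongr; linarith
    have h3 : 0 ≤ L * (√a + t + e) := by positivity
    have h4 : 0 ≤ 2 * C * L * t := by positivity
    linarith
  · have h2 : √a * √a ≤ L * √a := by gcongr; linarith
    rw [Real.mul_self_sqrt ha] at h2
    have h3 : 0 ≤ 2 * C * (L * (√a + t + e)) := by positivity
    have h4 : 0 ≤ L * (t + e) := by positivity
    linarith

/-- Every increment of `d` over `e²` is of order `le + l²`, so completing the square makes `√δ`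
Lipschitz in the disc parameter `l`. -/
theorem sqrt_le_sqrt_add_of_le {d e b t l C₁ C₂ R : ℝ} (hR : 0 < R) (hC₂ : 0 ≤ C₂) (he : 0 ≤ e)
    (hl : 0 ≤ l) (ht0 : 0 ≤ t) (ht : t ≤ C₁ * l) (hb : b ≤ C₂ * (l * e + l ^ 2))
    (hd : d ≤ e ^ 2 + b + t ^ 2 / (2 * R)) : √d ≤ e + (C₂ + C₁ ^ 2 / (2 * R) + 1) * l := by
  obtain ⟨Q, hQ⟩ : ∃ Q, Q = C₁ ^ 2 / (2 * R) := ⟨_, rfl⟩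
  have hQ0 : 0 ≤ Q := by rw [hQ]; positivity
  rw [← hQ]
  refine Real.sqrt_le_iff.2 ⟨by positivity, hd.trans ?_⟩
  have h1 : t ^ 2 / (2 * R) ≤ Q * l ^ 2 := by
    have : (C₁ * l) ^ 2 / (2 * R) = Q * l ^ 2 := by rw [hQ]; ring
    rw [← this]; gcongr
  have h2 : (e + (C₂ + Q + 1) * l) ^ 2 =
      e ^ 2 + C₂ * (l * e + l ^ 2) + Q * l ^ 2 + (C₂ * (l * e) + 2 * (Q + 1) * (l * e) +
        (C₂ + Q + 1 + (C₂ + Q) * (C₂ + Q + 1)) * l ^ 2 - (C₂ + Q) * l ^ 2) := by ring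
  have h3 : 0 ≤ C₂ * (l * e) + 2 * (Q + 1) * (l * e) +
      (1 + (C₂ + Q) * (C₂ + Q + 1)) * l ^ 2 := by positivity
  rw [h2]
  linarith

end Potential

/-! ### Assembly of the estimates -/

theorem theorem3 {n : ℕ} (D : Set (Cn n)) (hDo : IsOpen D) (hDc : IsConnected D)
    (hDb : Bornology.IsBounded D) (p : Cn n) (hp : IsC11BdryPoint D p) :
    ∃ U ∈ 𝓝 p,
      (∀ z ∈ D ∩ U,
        (∃! q, IsNearestBdryPoint D z q) ∧ DifferentiableAt ℝ (bdryDist D) z) ∧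
      (∃ c : ℝ, 0 < c ∧ ∀ z ∈ D ∩ U, ∀ w ∈ D ∩ U,
        ENNReal.ofReal (c * HD D z w) ≤ kobayashi D z w) ∧
      (∃ c : ℝ, 0 < c ∧ ∀ z ∈ D ∩ U, ∀ w ∈ D ∩ U,
        ENNReal.ofReal (c * (‖z - w‖ + |√(bdryDist D z) - √(bdryDist D w)|)) ≤
          kobayashi D z w) := by
  obtain ⟨hpf, V, s, K, hV, hpV, hs, hlipV, hsp, hDs⟩ := hp
  obtain ⟨N, r₀, R, M₀, hr₀, hR, hM₀, hN, hNl⟩ :=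
    exists_touchingBalls_of_lipschitz_fderiv hDo hV hpV hs hlipV hsp hDs
  obtain ⟨ν, r, M, hr, hr1, hM, hν, hlip⟩ := exists_normal_field hDo hpf hr₀ hR hM₀ hN hNl
  have hν' : ∀ z ∈ D ∩ Metric.ball p r, bdryDist D z ≤ r ∧ 0 < bdryDist D z ∧
        (∃! q, IsNearestBdryPoint D z q) ∧
        HasFDerivAt (bdryDist D) (innerSL ℝ (ν z)) z ∧
        ∃ q, z = q + bdryDist D z • ν z ∧ TouchingBalls D q (ν z) R := hν
  obtain ⟨B, hB0, hB⟩ : ∃ B : ℝ, 0 < B ∧ ∀ x ∈ D, ∀ y ∈ D, ‖y - x‖ ≤ B := by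
    obtain ⟨B, hB⟩ := Metric.isBounded_iff.1 hDb
    refine ⟨max B 1, by positivity, fun x hx y hy => ?_⟩
    rw [← dist_eq_norm]
    exact (hB hy hx).trans (le_max_left _ _)
  obtain ⟨C₂, hC₂⟩ : ∃ C₂, C₂ = 8 * (4 + (2 + B) ^ 2 / (2 * R)) + 4 * B := ⟨_, rfl⟩
  have hC₂0 : 0 ≤ C₂ := by rw [hC₂]; positivity
  have hmem : ∀ x y φ α, IsDiscJoining D x y φ α → x ∈ D ∧ y ∈ D := fun x y φ α hd =>
    ⟨hd.2.2.2.1 ▸ hd.2.1 (Metric.mem_ball_self one_pos), hd.2.2.2.2 ▸ hd.2.1 hd.2.2.1⟩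
  have hlin : ∀ x y φ α, IsDiscJoining D x y φ α → ‖y - x‖ ≤ B * ‖α‖ := fun x y φ α hd => by
    have := Complex.dist_le_div_mul_dist_of_mapsTo_ball (f := φ) (c := 0) (R₁ := 1) (R₂ := B)
      hd.1 (fun ζ hζ => by
        rw [Metric.mem_closedBall, dist_eq_norm, hd.2.2.2.1]
        exact hB _ (hmem x y φ α hd).1 _ (hd.2.1 hζ)) hd.2.2.1
    simpa [dist_eq_norm, hd.2.2.2.1, hd.2.2.2.2] using this
  have hnorm : ∀ x y φ α, x ∈ Metric.ball p r → IsDiscJoining D x y φ α →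
      ‖herm (y - x) (ν x)‖ ≤ C₂ * (‖α‖ * √(bdryDist D x) + ‖α‖ ^ 2) :=
    fun x y φ α hx hd => by
      obtain ⟨h1, h2, -, -, q, hq, hT⟩ := hν' x ⟨(hmem x y φ α hd).1, hx⟩
      have := (norm_herm_le_of_touching hB0 hB hR hT h2 (h1.trans hr1) hq hd.1 hd.2.1 hd.2.2.1
        hd.2.2.2.1).2
      rwa [hd.2.2.2.2, ← hC₂] at this
  obtain ⟨C₃, hC₃⟩ : ∃ C₃, C₃ = C₂ + B ^ 2 / (2 * R) + 1 := ⟨_, rfl⟩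
  have hC₃0 : 0 ≤ C₃ := by rw [hC₃]; positivity
  have hsqrt : ∀ x y φ α, x ∈ Metric.ball p r → IsDiscJoining D x y φ α →
      √(bdryDist D y) ≤ √(bdryDist D x) + C₃ * ‖α‖ := fun x y φ α hx hd => by
    obtain ⟨h1, h2, -, -, q, hq, hT⟩ := hν' x ⟨(hmem x y φ α hd).1, hx⟩
    have h3 := hT.infDist_le hR h2.le hq (hmem x y φ α hd).2
    rw [inner_real_eq_re_herm] at h3
    rw [hC₃]
    refine sqrt_le_sqrt_add_of_le hR hC₂0 (Real.sqrt_nonneg _) (norm_nonneg _) (norm_nonneg _)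
      (hlin x y φ α hd) ((Complex.re_le_norm _).trans (hnorm x y φ α hx hd)) ?_
    rw [Real.sq_sqrt h2.le]
    exact h3
  have hsub : Metric.ball p (r / 2) ⊆ Metric.ball p r := Metric.ball_subset_ball (by linarith)
  have hcon := fun z hz => exists_disc_contraction (z := z) hr hB0 hC₂0 hC₃0 hM hz hlip hlin
    hnorm hsqrt
  obtain ⟨C₄, hC₄⟩ : ∃ C₄, C₄ = C₂ + C₂ * C₃ + B ^ 2 * M := ⟨_, rfl⟩
  have hC₄0 : 0 ≤ C₄ := by rw [hC₄]; positivity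
  obtain ⟨ε, hε⟩ : ∃ ε, ε = r / (2 * B) := ⟨_, rfl⟩
  have hε0 : 0 < ε := by rw [hε]; positivity
  rw [← hC₄, ← hε] at hcon
  have hclose : ∀ z ∈ D ∩ Metric.ball p (r / 2), ∀ w ∈ D ∩ Metric.ball p (r / 2),
      ‖z - w‖ ≤ 1 := fun z hz w hw => by
    have h1 := dist_triangle_right z w p
    have h2 := Metric.mem_ball.1 hz.2
    have h3 := Metric.mem_ball.1 hw.2
    rw [← dist_eq_norm]; linarith
  have hsqrt1 : ∀ z ∈ D ∩ Metric.ball p (r / 2), √(bdryDist D z) ≤ 1 := fun z hz =>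
    Real.sqrt_le_one.2 ((hν' z ⟨hz.1, hsub hz.2⟩).1.trans hr1)
  refine ⟨Metric.ball p (r / 2), Metric.ball_mem_nhds p (by linarith), fun z hz => ?_, ?_, ?_⟩
  · obtain ⟨-, -, h1, h2, -⟩ := hν' z ⟨hz.1, hsub hz.2⟩
    exact ⟨h1, h2.differentiableAt⟩
  -- Both summands of `HD` are at most `1` here, so the factor `ε / 2` keeps the bound below the
  -- cap.
  · refine ⟨min (1 / (2 * C₄ + 1 + B)) (ε / 2), by positivity, fun z hz w hw => ?_⟩
    obtain ⟨-, -, -, hder, q, -, hT⟩ := hν' z ⟨hz.1, hsub hz.2⟩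
    obtain ⟨f, hf0, hf, hfw⟩ := hcon z hz
    refine le_trans (ENNReal.ofReal_le_ofReal ?_) (ofReal_abs_sub_le_kobayashi hf z w)
    rw [hf0, zero_sub, abs_neg]
    refine le_trans ?_ (le_abs_self _)
    have hherm : ‖normalComp D z (z - w)‖ = ‖herm (w - z) (ν z)‖ := by
      rw [normalComp_eq_herm hder, ← norm_neg, herm_sub_left, herm_sub_left, neg_sub]
    have ha1 : ‖herm (w - z) (ν z)‖ ≤ ‖z - w‖ := by
      have := norm_herm_le (w - z) (ν z)
      rwa [hT.norm_eq, mul_one, norm_sub_rev] at this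
    rw [HD, hherm]
    obtain ⟨a, ha⟩ : ∃ a, a = ‖herm (w - z) (ν z)‖ := ⟨_, rfl⟩
    obtain ⟨t, ht⟩ : ∃ t, t = ‖z - w‖ := ⟨_, rfl⟩
    obtain ⟨e, he⟩ : ∃ e, e = √(bdryDist D z) := ⟨_, rfl⟩
    have ha0 : 0 ≤ a := ha ▸ norm_nonneg _
    have ht0 : 0 ≤ t := ht ▸ norm_nonneg _
    have he0 : 0 ≤ e := he ▸ Real.sqrt_nonneg _
    have ht1 : t ≤ 1 := ht ▸ hclose z hz w hw
    rw [← ha, ← ht] at ha1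
    rw [← ha, ← ht, ← he]
    refine hfw w _ ?_ fun L hL0 hL1 _ hL3 => ?_
    · have h1 : a / (√a + t + e) ≤ 1 := by
        refine div_le_one_of_le₀ ?_ (by positivity)
        have h2 : a ≤ t := ha1
        linarith [Real.sqrt_nonneg a]
      calc _ ≤ ε / 2 * (1 + 1) := by
            gcongr
            exact min_le_right _ _
        _ = ε := by ring
    · rw [← ha, ← he] at hL3
      rw [norm_sub_rev, ← ht] at hL1
      have h1 := div_sqrt_add_le ha0 ht0 he0 hL0 hC₄0 hL3
      calc _ ≤ 1 / (2 * C₄ + 1 + B) * ((2 * C₄ + 1) * L + B * L) := by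
            gcongr
            exact min_le_left _ _
        _ = L := by field_simp
  · obtain ⟨c, hc⟩ : ∃ c, c = min (1 / (B + C₃)) (ε / 2) := ⟨_, rfl⟩
    have hc0 : 0 < c := by rw [hc]; positivity
    -- The potential controls only the increase of `√δ` away from its base point, so the base is
    -- later taken at the endpoint with the smaller `δ`.
    have hone : ∀ z ∈ D ∩ Metric.ball p (r / 2), ∀ w ∈ D ∩ Metric.ball p (r / 2),
        ∃ f : Cn n → ℝ, (∀ x y φ α, IsDiscJoining D x y φ α → f y ≤ f x + ‖α‖) ∧
          c * (‖z - w‖ + (√(bdryDist D w) - √(bdryDist D z))) ≤ |f z - f w| :=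
      fun z hz w hw => by
        obtain ⟨f, hf0, hf, hfw⟩ := hcon z hz
        refine ⟨f, hf, ?_⟩
        rw [hf0, zero_sub, abs_neg]
        refine le_trans ?_ (le_abs_self _)
        refine hfw w _ ?_ fun L hL0 hL1 hL2 _ => ?_
        · have h1 := hclose z hz w hw
          have h2 := hsqrt1 w hw
          have h3 := Real.sqrt_nonneg (bdryDist D z)
          calc _ ≤ c * (1 + 1) := by gcongr; linarith
            _ ≤ ε / 2 * (1 + 1) := by gcongr; rw [hc]; exact min_le_right _ _
            _ = ε := by ring
        · rw [norm_sub_rev] at hL1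
          calc _ ≤ c * (B * L + C₃ * L) := by gcongr; linarith
            _ ≤ 1 / (B + C₃) * (B * L + C₃ * L) := by gcongr; rw [hc]; exact min_le_left _ _
            _ = L := by field_simp
    refine ⟨c, hc0, fun z hz w hw => ?_⟩
    rcases le_total (√(bdryDist D z)) (√(bdryDist D w)) with h | h
    · obtain ⟨f, hf, hle⟩ := hone z hz w hw
      refine le_trans (ENNReal.ofReal_le_ofReal ?_) (ofReal_abs_sub_le_kobayashi hf z w)
      rwa [abs_sub_comm, abs_of_nonneg (sub_nonneg.2 h)]
    · obtain ⟨f, hf, hle⟩ := hone w hw z hz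
      refine le_trans (ENNReal.ofReal_le_ofReal ?_) (ofReal_abs_sub_le_kobayashi hf z w)
      rwa [abs_of_nonneg (sub_nonneg.2 h), norm_sub_rev, abs_sub_comm (f z)]
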